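/- Let $G$ be a finite undirected graph with node set $V$, possibly with nonnegative edge weights or multiple edges and with self-loops, and let every node $v$ have a size $\|v\|\ge 0$ (for the Constant Potts Model, $\|v\|=1$). For sets of nodes $C,D\subseteq V$ put $\|C\|=\sum_{v\in C}\|v\|$ and let $E(C,D)$ be the total weight of the edges with one end in $C$ and the other end in $D$, each edge counted once. Let $\gamma>0$ be the resolution parameter, $\theta>0$ the randomness parameter, and for a partition $\mathcal P$ of $V$ let $$\mathcal H(\mathcal P)=\sum_{C\in\mathcal P}\Bigl[E(C,C)-\gamma\,\tfrac{\|C\|(\|C\|-1)}2\Bigr].$$ Write $\mathcal P(S\mapsto D)$ for the partition obtained by moving the node set $S$ to $D\in\mathcal P$, or to a new community if $D=\emptyset$, and $\Delta\mathcal H(S\mapsto D)=\mathcal H(\mathcal P(S\mapsto D))-\mathcal H(\mathcal P)$. One iteration $\mathcal P'=\mathrm{Leiden}(G,\mathcal P)$ of the Leiden algorithm is the following randomized procedure. 1. (Fast local moving.) Put all nodes in a queue, in random order. While the queue is not empty, remove its first node $v$ and let $C'$ maximize $\Delta\mathcal H(v\mapsto C)$ over $C\in\mathcal P\cup\{\emptyset\}$.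 If $\Delta\mathcal H(v\mapsto C')>0$, move $v$ to $C'$ and add to the rear of the queue those neighbours of $v$ that are neither in $v$'s new community nor in the queue. 2. If every community of $\mathcal P$ now consists of a single node, stop and return $\mathcal P$ as a partition of the original node set. 3. (Refinement.) Start with the partition $\mathcal R$ into singletons. For every community $S\in\mathcal P$, visit in random order the nodes $v\in S$ with $E(v,S-v)\ge\gamma\|v\|(\|S\|-\|v\|)$. If $\{v\}\in\mathcal R$ when $v$ is visited, move $v$ to a random community $C\in\mathcal R$ among those with $C\subseteq S$ and $E(C,S-C)\ge\gamma\|C\|(\|S\|-\|C\|)$. Here $C$ is chosen with probability proportional to $\exp(\frac1\theta\Delta\mathcal H_{\mathcal R}(v\mapsto C))$ if $\Delta\mathcal H_{\mathcal R}(v\mapsto C)\ge0$, and with probability $0$ otherwise. 4. (Aggregation.) Replace $G$ by the aggregate graph: its nodes are the communities of $\mathcal R$, and sizes and edge weights are summed. Replace $\mathcal P$ by the partition of these nodes that it induces, and go back to step 1. Ties in the maximization, and the order in which neighbours are added to the queue, are resolved by an arbitrary fixed rule. A partition $\mathcal P$ of $V$ is *asymptotically stable* if, in every sequence $\mathcal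 P_0,\mathcal P_1,\dots$ with $\mathcal P_{t+1}=\mathrm{Leiden}(G,\mathcal P_t)$ that the algorithm can produce and in which $\mathcal P_\tau=\mathcal P$, one has $\mathcal P_t=\mathcal P$ for all $t\ge\tau$. Here "can produce" means that every random choice made has positive probability. **Corollary.** If $\mathcal P$ is asymptotically stable, then $\mathcal P$ is uniformly $\gamma$-dense: $\Delta\mathcal H(S\mapsto\emptyset)\le0$ for every $C\in\mathcal P$ and every $S\subseteq C$. In other words, $E(S,C-S)\ge\gamma\,\|S\|\,\|C-S\|$ for every community $C\in\mathcal P$ and every $S\subseteq C$. -/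

import Mathlib

open scoped NNReal Classical

universe u

noncomputable section

/-- A finite undirected weighted graph with node set `W`.  Edges are unordered pairs of nodes
(self-loops allowed) and `weight e` is the weight of `e`, i.e. its multiplicity in the case of a
multigraph; weight `0` means that there is no edge.  `size v` is the size `‖v‖` of a node. -/
structure Network (W : Type u) where
  weight : Sym2 W → ℝ≥0
  size : W → ℝ≥0

namespace Network

variable {W : Type u} [Fintype W] [DecidableEq W]

/-- `E(C, D)`: the total weight of the edges having one end in `C` and the other end in `D`.
Each edge is counted once, in particular in `E(C, C)`. -/
def E (G : Network W) (C D : Finset W) : ℝ≥0 :=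
  ∑ e : Sym2 W with ∃ u ∈ C, ∃ v ∈ D, e = s(u, v), G.weight e

theorem E_comm (G : Network W) (C D : Finset W) : G.E C D = G.E D C := by
  unfold E
  congr 1
  ext e
  simp only [Finset.mem_filter, Finset.mem_univ, true_and]
  constructor
  · rintro ⟨u, hu, v, hv, h⟩
    exact ⟨v, hv, u, hu, h.trans Sym2.eq_swap⟩
  · rintro ⟨u, hu, v, hv, h⟩
    exact ⟨v, hv, u, hu, h.trans Sym2.eq_swap⟩

/-- The recursive size `‖C‖` of a set of nodes. -/
def norm (G : Network W) (C : Finset W) : ℝ≥0 := ∑ v ∈ C, G.size v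

/-- The Constant Potts Model quality
`H(G, P) = ∑_{C ∈ P} [E(C, C) - γ * binom(‖C‖, 2)]` of a partition `P` (a set of sets of nodes). -/
def quality (G : Network W) (γ : ℝ) (P : Finset (Finset W)) : ℝ :=
  ∑ C ∈ P, ((G.E C C : ℝ) - γ * ((G.norm C : ℝ) * ((G.norm C : ℝ) - 1) / 2))

end Network

namespace Leiden

variable {W : Type u} [Fintype W] [DecidableEq W]

/-- `P(S ↦ D)`: the partition obtained from `P` by moving the nodes of `S` to the community
`D ∈ P`, or to a new community if `D = ∅`. -/
def move (P : Finset (Finset W)) (S D : Finset W) : Finset (Finset W) :=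
  (insert (D ∪ S) (P.image fun C => C \ (D ∪ S))).erase ∅

/-- `ΔH_P(S ↦ D)`. -/
def gain (G : Network W) (γ : ℝ) (P : Finset (Finset W)) (S D : Finset W) : ℝ :=
  G.quality γ (move P S D) - G.quality γ P

/-- The choices that the description of the algorithm leaves open: which maximizer is returned by
`argmax` in case of ties, and in which order newly added nodes are put at the rear of the queue. -/
structure Policy (γ : ℝ) where
  best : ∀ {W : Type u} [Fintype W] [DecidableEq W],
    Network W → Finset (Finset W) → W → Finset W
  best_mem : ∀ {W : Type u} [Fintype W] [DecidableEq W]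
    (G : Network W) (P : Finset (Finset W)) (v : W), best G P v ∈ insert ∅ P
  gain_le_best : ∀ {W : Type u} [Fintype W] [DecidableEq W]
    (G : Network W) (P : Finset (Finset W)) (v : W), ∀ D ∈ insert ∅ P,
      gain G γ P {v} D ≤ gain G γ P {v} (best G P v)
  enum : ∀ {W : Type u} [Fintype W] [DecidableEq W], Finset W → List W
  enum_nodup : ∀ {W : Type u} [Fintype W] [DecidableEq W] (N : Finset W), (enum N).Nodup
  mem_enum : ∀ {W : Type u} [Fintype W] [DecidableEq W] (N : Finset W) (v : W),
    v ∈ enum N ↔ v ∈ N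

/-- The neighbours of `v` that are not in the community `C`. -/
def outsideNeighbours (G : Network W) (v : W) (C : Finset W) : Finset W :=
  Finset.univ.filter fun u => 0 < G.weight s(u, v) ∧ u ∉ C

/-- `MoveLoop π G P q P'`: the loop of `MoveNodesFast`, started with partition `P` and queue `q`
(front of the queue first), ends with the partition `P'`. -/
inductive MoveLoop {γ : ℝ} (π : Policy.{u} γ) (G : Network W) :
    Finset (Finset W) → List W → Finset (Finset W) → Prop
  | done (P : Finset (Finset W)) : MoveLoop π G P [] P
  | stay {P P' : Finset (Finset W)} {v : W} {q : List W}
      (h : ¬ 0 < gain G γ P {v} (π.best G P v))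
      (rest : MoveLoop π G P q P') :
      MoveLoop π G P (v :: q) P'
  | move {P P' : Finset (Finset W)} {v : W} {q : List W}
      (h : 0 < gain G γ P {v} (π.best G P v))
      (rest : MoveLoop π G (Leiden.move P {v} (π.best G P v))
        (q ++ π.enum (outsideNeighbours G v (π.best G P v ∪ {v}) \ q.toFinset)) P') :
      MoveLoop π G P (v :: q) P'

/-- `P'` is a possible result of `MoveNodesFast(G, P)`: initially the queue contains all nodes, in
a random order. -/
def MoveNodesFast {γ : ℝ} (π : Policy.{u} γ) (G : Network W) (P P' : Finset (Finset W)) : Prop :=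
  ∃ q : List W, q.Nodup ∧ (∀ v, v ∈ q) ∧ MoveLoop π G P q P'

/-- `A ⊆ S` is well connected within `S`: `E(A, S - A) ≥ γ ‖A‖ (‖S‖ - ‖A‖)`. -/
def WellConnected (G : Network W) (γ : ℝ) (S A : Finset W) : Prop :=
  γ * (G.norm A : ℝ) * ((G.norm S : ℝ) - (G.norm A : ℝ)) ≤ (G.E A (S \ A) : ℝ)

/-- The set `R` of `MergeNodesSubset`: the nodes that are well connected within `S`. -/
def wellConnectedNodes (G : Network W) (γ : ℝ) (S : Finset W) : Finset W :=
  S.filter fun v => WellConnected G γ S {v}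

/-- The set `T` of `MergeNodesSubset`: the well connected communities of `P` contained in `S`. -/
def mergeTargets (G : Network W) (γ : ℝ) (S : Finset W) (P : Finset (Finset W)) :
    Finset (Finset W) :=
  P.filter fun C => C ⊆ S ∧ WellConnected G γ S C

/-- The unnormalized probability of moving `v` to the community `C`. -/
def mergeWeight (G : Network W) (γ θ : ℝ) (P : Finset (Finset W)) (v : W) (C : Finset W) : ℝ :=
  if 0 ≤ gain G γ P {v} C then Real.exp (1 / θ * gain G γ P {v} C) else 0

/-- The probability `Pr(C' = C)` that the community chosen for `v` is `C`. -/
def mergeProb (G : Network W) (γ θ : ℝ) (S : Finset W) (P : Finset (Finset W)) (v : W)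
    (C : Finset W) : ℝ :=
  if C ∈ mergeTargets G γ S P then
    mergeWeight G γ θ P v C / ∑ D ∈ mergeTargets G γ S P, mergeWeight G γ θ P v D
  else 0

/-- `MergeLoop G γ θ S P l P'`: visiting the nodes of the list `l` in `MergeNodesSubset`, starting
with the partition `P`, can (with positive probability) result in `P'`. -/
inductive MergeLoop (G : Network W) (γ θ : ℝ) (S : Finset W) :
    Finset (Finset W) → List W → Finset (Finset W) → Prop
  | done (P : Finset (Finset W)) : MergeLoop G γ θ S P [] P
  | skip {P P' : Finset (Finset W)} {v : W} {l : List W}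
      (h : {v} ∉ P)
      (rest : MergeLoop G γ θ S P l P') :
      MergeLoop G γ θ S P (v :: l) P'
  | merge {P P' : Finset (Finset W)} {v : W} {l : List W} (C : Finset W)
      (h : {v} ∈ P)
      (hC : 0 < mergeProb G γ θ S P v C)
      (rest : MergeLoop G γ θ S (move P {v} C) l P') :
      MergeLoop G γ θ S P (v :: l) P'

/-- `P'` is a possible result of `MergeNodesSubset(G, P, S)`; the nodes of `R` are visited in a
random order. -/
def MergeNodesSubset (G : Network W) (γ θ : ℝ) (P : Finset (Finset W)) (S : Finset W)
    (P' : Finset (Finset W)) : Prop :=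
  ∃ l : List W, l.Nodup ∧ (∀ v, v ∈ l ↔ v ∈ wellConnectedNodes G γ S) ∧ MergeLoop G γ θ S P l P'

/-- Refining one after the other the communities in a list. -/
inductive RefineLoop (G : Network W) (γ θ : ℝ) :
    Finset (Finset W) → List (Finset W) → Finset (Finset W) → Prop
  | done (R : Finset (Finset W)) : RefineLoop G γ θ R [] R
  | next {R R₁ R' : Finset (Finset W)} {C : Finset W} {l : List (Finset W)}
      (h : MergeNodesSubset G γ θ R C R₁)
      (rest : RefineLoop G γ θ R₁ l R') :
      RefineLoop G γ θ R (C :: l) R'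

variable (W) in
/-- The singleton partition. -/
def singletonPartition : Finset (Finset W) :=
  Finset.univ.image fun v : W => {v}

/-- `R` is a possible result of `RefinePartition(G, P)`. -/
def RefinePartition (G : Network W) (γ θ : ℝ) (P R : Finset (Finset W)) : Prop :=
  ∃ l : List (Finset W), l.Nodup ∧ (∀ C, C ∈ l ↔ C ∈ P) ∧
    RefineLoop G γ θ (singletonPartition W) l R

/-- `AggregateGraph(G, R)`: the nodes are the communities of `R`, the edges between two nodes are
the edges of `G` between the two communities, and the size of a node is its recursive size. -/
def aggregateGraph (G : Network W) (R : Finset (Finset W)) : Network R where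
  weight := Sym2.lift ⟨fun C D => G.E C.1 D.1, fun C D => G.E_comm C.1 D.1⟩
  size := fun C => G.norm C.1

/-- The partition `{{v | v ⊆ C, v ∈ R} | C ∈ P}` of the aggregate graph. -/
def aggregatePartition (R P : Finset (Finset W)) : Finset (Finset R) :=
  P.image fun C => Finset.univ.filter fun v : R => v.1 ⊆ C

/-- The partition of `W` equivalent to a partition of the aggregate graph, obtained by replacing
each community by the union of its elements.  Doing this for all levels of aggregation amounts to
the flattening operation `flat*`. -/
def flattenPartition {R : Finset (Finset W)} (Q : Finset (Finset R)) : Finset (Finset W) :=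
  Q.image fun C => C.biUnion fun v => v.1

/-- `LeidenStep π θ G P P'`: one iteration of the Leiden algorithm can result in `P'`, that is, `P'`
is a possible value of `Leiden(G, P)`. -/
inductive LeidenStep {γ : ℝ} (π : Policy.{u} γ) (θ : ℝ) :
    ∀ {W : Type u} [Fintype W] [DecidableEq W],
      Network W → Finset (Finset W) → Finset (Finset W) → Prop
  | finish {W : Type u} [Fintype W] [DecidableEq W] {G : Network W} {P P₁ : Finset (Finset W)}
      (hmove : MoveNodesFast π G P P₁)
      (hdone : P₁.card = Fintype.card W) :
      LeidenStep π θ G P P₁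
  | level {W : Type u} [Fintype W] [DecidableEq W] {G : Network W}
      {P P₁ R : Finset (Finset W)} {Q : Finset (Finset R)}
      (hmove : MoveNodesFast π G P P₁)
      (hdone : P₁.card ≠ Fintype.card W)
      (hrefine : RefinePartition G γ θ P₁ R)
      (hrec : LeidenStep π θ (aggregateGraph G R) (aggregatePartition R P₁) Q) :
      LeidenStep π θ G P (flattenPartition Q)

/-- `P` is asymptotically stable: whenever iterating the Leiden algorithm, `P_{t+1} = Leiden(G, P_t)`,
produces `P_τ = P`, one has `P_t = P` for all `t ≥ τ`. -/
def AsymptoticallyStable {γ : ℝ} (π : Policy.{u} γ) (θ : ℝ) (G : Network W)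
    (P : Finset (Finset W)) : Prop :=
  ∀ (Ps : ℕ → Finset (Finset W)) (τ : ℕ),
    (∀ t, LeidenStep π θ G (Ps t) (Ps (t + 1))) → Ps τ = P → ∀ t, τ ≤ t → Ps t = P

/-- `P` is uniformly `γ`-dense: no subset of a community can be split off with profit. -/
def UniformlyDense (G : Network W) (γ : ℝ) (P : Finset (Finset W)) : Prop :=
  ∀ C ∈ P, ∀ S ⊆ C, gain G γ P S ∅ ≤ 0

end Leiden

end

set_option linter.unusedSectionVars false

/-! Put g(A, B) = E(A, B) - γ‖A‖‖B‖ (`cutGain`). It is symmetric and additive over disjoint unions,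
and splitting S off a community C changes the quality by -g(S, C \ S). Density of P therefore means
g(S, C \ S) ≥ 0 throughout.

Suppose P is asymptotically stable but some set violates this inequality; let T ⊆ C be a minimal
one. For a nonempty proper A ⊂ T with B = T \ A, minimality gives g(A, C \ A) ≥ 0 and g(B, C \ B) ≥
0. Their sum is 2g(A, B) + g(T, C \ T), so g(A, B) > 0, and by additivity some node of B can join A
without loss. As proper subsets of T are also well connected, refinement can build T node by node
with positive probability (`refinePartition_mergedPartition`). In the aggregate graph T is a single
node whose removal from C is profitable, so local moving at that level strictly raises the quality.

To contradict stability, this beginning has to extend to a finished iteration and then to an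
infinite sequence. `exists_leidenStep_of_card_le` supplies, from every partition, a terminating run
that never lowers the quality. Its measure is the number of attainable qualities above the current
one plus the number of nodes. -/

namespace Network

variable {W : Type u} [Fintype W] [DecidableEq W]

/-! ### Additivity of edge weights, sizes and cut gains -/

/-- Only `A` has to avoid `D`: an edge counted in both terms would join a node of `A` to a node of
`B`, and its end in `A` would have to lie in `D`. -/
theorem E_union_left (G : Network W) {A B D : Finset W} (hAB : Disjoint A B)
    (hAD : Disjoint A D) : G.E (A ∪ B) D = G.E A D + G.E B D := by
  unfold E
  rw [← Finset.sum_union]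
  · congr 1
    ext e
    simp only [Finset.mem_filter, Finset.mem_univ, true_and, Finset.mem_union]
    constructor
    · rintro ⟨u, hu | hu, v, hv, h⟩
      · exact Or.inl ⟨u, hu, v, hv, h⟩
      · exact Or.inr ⟨u, hu, v, hv, h⟩
    · rintro (⟨u, hu, v, hv, h⟩ | ⟨u, hu, v, hv, h⟩)
      · exact ⟨u, Or.inl hu, v, hv, h⟩
      · exact ⟨u, Or.inr hu, v, hv, h⟩
  · rw [Finset.disjoint_left]
    intro e
    simp only [Finset.mem_filter, Finset.mem_univ, true_and]
    rintro ⟨u, hu, v, hv, rfl⟩ ⟨u', hu', v', hv', h⟩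
    rw [Sym2.eq_iff] at h
    rcases h with ⟨rfl, rfl⟩ | ⟨rfl, rfl⟩
    · exact Finset.disjoint_left.1 hAB hu hu'
    · exact Finset.disjoint_left.1 hAD hu hv'

theorem E_union_self (G : Network W) {A B : Finset W} (hAB : Disjoint A B) :
    G.E (A ∪ B) (A ∪ B) = G.E A A + G.E B B + G.E A B := by
  unfold E
  rw [← Finset.sum_union, ← Finset.sum_union]
  · congr 1
    ext e
    simp only [Finset.mem_filter, Finset.mem_univ, true_and, Finset.mem_union]
    constructor
    · rintro ⟨u, hu | hu, v, hv | hv, h⟩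
      · exact Or.inl (Or.inl ⟨u, hu, v, hv, h⟩)
      · exact Or.inr ⟨u, hu, v, hv, h⟩
      · exact Or.inr ⟨v, hv, u, hu, h.trans Sym2.eq_swap⟩
      · exact Or.inl (Or.inr ⟨u, hu, v, hv, h⟩)
    · rintro ((⟨u, hu, v, hv, h⟩ | ⟨u, hu, v, hv, h⟩) | ⟨u, hu, v, hv, h⟩)
      · exact ⟨u, Or.inl hu, v, Or.inl hv, h⟩
      · exact ⟨u, Or.inr hu, v, Or.inr hv, h⟩
      · exact ⟨u, Or.inl hu, v, Or.inr hv, h⟩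
  · rw [Finset.disjoint_left] at hAB ⊢
    intro e
    simp only [Finset.mem_filter, Finset.mem_univ, true_and, Finset.mem_union]
    rintro (⟨u, hu, v, hv, rfl⟩ | ⟨u, hu, v, hv, rfl⟩) ⟨u', hu', v', hv', h⟩ <;>
    · rw [Sym2.eq_iff] at h
      rcases h with ⟨rfl, rfl⟩ | ⟨rfl, rfl⟩ <;> grind
  · rw [Finset.disjoint_left] at hAB ⊢
    intro e
    simp only [Finset.mem_filter, Finset.mem_univ, true_and]
    rintro ⟨u, hu, v, hv, rfl⟩ ⟨u', hu', v', hv', h⟩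
    rw [Sym2.eq_iff] at h
    rcases h with ⟨rfl, rfl⟩ | ⟨rfl, rfl⟩ <;> grind

theorem norm_union (G : Network W) {A B : Finset W} (hAB : Disjoint A B) :
    G.norm (A ∪ B) = G.norm A + G.norm B :=
  Finset.sum_union hAB

theorem E_empty_left (G : Network W) (D : Finset W) : G.E ∅ D = 0 := by
  simp [E]

theorem norm_empty (G : Network W) : G.norm ∅ = 0 := rfl

/-- The contribution of a single community to the quality of a partition. -/
noncomputable def blockQuality (G : Network W) (γ : ℝ) (C : Finset W) : ℝ :=
  (G.E C C : ℝ) - γ * ((G.norm C : ℝ) * ((G.norm C : ℝ) - 1) / 2)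

/-- The gain of merging two disjoint communities. -/
noncomputable def cutGain (G : Network W) (γ : ℝ) (A B : Finset W) : ℝ :=
  (G.E A B : ℝ) - γ * (G.norm A : ℝ) * (G.norm B : ℝ)

theorem quality_eq_sum (G : Network W) (γ : ℝ) (P : Finset (Finset W)) :
    G.quality γ P = ∑ C ∈ P, G.blockQuality γ C := rfl

theorem blockQuality_empty (G : Network W) (γ : ℝ) : G.blockQuality γ ∅ = 0 := by
  simp [blockQuality, E_empty_left, norm_empty]

theorem blockQuality_union (G : Network W) (γ : ℝ) {A B : Finset W} (hAB : Disjoint A B) :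
    G.blockQuality γ (A ∪ B) =
      G.blockQuality γ A + G.blockQuality γ B + G.cutGain γ A B := by
  simp only [blockQuality, cutGain, E_union_self G hAB, norm_union G hAB, NNReal.coe_add]
  ring

theorem cutGain_comm (G : Network W) (γ : ℝ) (A B : Finset W) :
    G.cutGain γ A B = G.cutGain γ B A := by
  simp only [cutGain, G.E_comm A B]
  ring

theorem cutGain_empty_left (G : Network W) (γ : ℝ) (B : Finset W) : G.cutGain γ ∅ B = 0 := by
  simp [cutGain, E_empty_left, norm_empty]

theorem cutGain_union_left (G : Network W) (γ : ℝ) {A B D : Finset W} (hAB : Disjoint A B)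
    (hAD : Disjoint A D) :
    G.cutGain γ (A ∪ B) D = G.cutGain γ A D + G.cutGain γ B D := by
  simp only [cutGain, E_union_left G hAB hAD, norm_union G hAB, NNReal.coe_add]
  ring

theorem cutGain_union_right (G : Network W) (γ : ℝ) {A B D : Finset W} (hDA : Disjoint D A)
    (hAB : Disjoint A B) :
    G.cutGain γ D (A ∪ B) = G.cutGain γ D A + G.cutGain γ D B := by
  rw [cutGain_comm, cutGain_union_left G γ hAB hDA.symm, G.cutGain_comm γ A, G.cutGain_comm γ B]

/-- Used for averaging: a sign of the total passes to at least one node of `A`. -/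
theorem cutGain_eq_sum (G : Network W) (γ : ℝ) {A D : Finset W} (hAD : Disjoint A D) :
    G.cutGain γ A D = ∑ v ∈ A, G.cutGain γ {v} D := by
  induction A using Finset.induction_on with
  | empty => simp [cutGain_empty_left]
  | insert a s ha ih =>
    rw [Finset.disjoint_insert_left] at hAD
    rw [Finset.sum_insert ha, Finset.insert_eq, cutGain_union_left, ih hAD.2]
    · simpa using ha
    · simpa using hAD.1

end Network

/-! ### Partitions and the effect of a move on the quality -/

namespace Leiden

variable {W : Type u} [Fintype W] [DecidableEq W]

open Network

theorem wellConnected_iff (G : Network W) (γ : ℝ) {S A : Finset W} (hA : A ⊆ S) :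
    WellConnected G γ S A ↔ 0 ≤ G.cutGain γ A (S \ A) := by
  have h := G.norm_union (Finset.disjoint_sdiff (s := A) (t := S))
  rw [Finset.union_sdiff_of_subset hA] at h
  rw [WellConnected, h, cutGain, sub_nonneg, NNReal.coe_add, add_sub_cancel_left]

/-- The nonempty members of `P` cover every node exactly once. -/
structure IsNodePartition (P : Finset (Finset W)) : Prop where
  nonempty : ∀ C ∈ P, C.Nonempty
  exists_mem : ∀ v, ∃ C ∈ P, v ∈ C
  eq_of_mem : ∀ C ∈ P, ∀ D ∈ P, ∀ v, v ∈ C → v ∈ D → C = D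

theorem isNodePartition_parts (P : Finpartition (Finset.univ : Finset W)) :
    IsNodePartition P.parts where
  nonempty _ hC := P.nonempty_of_mem_parts hC
  exists_mem v := P.exists_mem (Finset.mem_univ v)
  eq_of_mem _ hC _ hD _ h h' := P.eq_of_mem_parts hC hD h h'

namespace IsNodePartition

variable {P : Finset (Finset W)}

theorem empty_notMem (hP : IsNodePartition P) : ∅ ∉ P := fun h => by
  simpa using hP.nonempty _ h

theorem disjoint (hP : IsNodePartition P) {C D : Finset W} (hC : C ∈ P) (hD : D ∈ P)
    (h : C ≠ D) : Disjoint C D :=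
  Finset.disjoint_left.2 fun v hv hv' => h (hP.eq_of_mem C hC D hD v hv hv')

theorem mem_move {S D X : Finset W} :
    X ∈ move P S D ↔ X ≠ ∅ ∧ (X = D ∪ S ∨ ∃ C ∈ P, C \ (D ∪ S) = X) := by
  simp [move]

theorem move (hP : IsNodePartition P) (S D : Finset W) : IsNodePartition (move P S D) where
  nonempty C hC := Finset.nonempty_iff_ne_empty.2 (mem_move.1 hC).1
  exists_mem v := by
    by_cases hv : v ∈ D ∪ S
    · exact ⟨D ∪ S, mem_move.2 ⟨Finset.ne_empty_of_mem hv, Or.inl rfl⟩, hv⟩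
    · obtain ⟨C, hC, hvC⟩ := hP.exists_mem v
      have : v ∈ C \ (D ∪ S) := Finset.mem_sdiff.2 ⟨hvC, hv⟩
      exact ⟨_, mem_move.2 ⟨Finset.ne_empty_of_mem this, Or.inr ⟨C, hC, rfl⟩⟩, this⟩
  eq_of_mem X hX Y hY v hvX hvY := by
    obtain ⟨-, rfl | ⟨C, hC, rfl⟩⟩ := mem_move.1 hX <;>
    obtain ⟨-, rfl | ⟨C', hC', rfl⟩⟩ := mem_move.1 hY
    · rfl
    · exact absurd hvX (Finset.mem_sdiff.1 hvY).2
    · exact absurd hvY (Finset.mem_sdiff.1 hvX).2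
    · rw [hP.eq_of_mem C hC C' hC' v (Finset.mem_sdiff.1 hvX).1 (Finset.mem_sdiff.1 hvY).1]

/-- Removing `∅` and identifying equal sets in `move` costs nothing, because different communities
can only leave equal remainders if these are empty, and the empty block has quality 0. -/
theorem quality_move (hP : IsNodePartition P) (G : Network W) (γ : ℝ) (S D : Finset W) :
    G.quality γ (Leiden.move P S D) =
      G.blockQuality γ (D ∪ S) + ∑ C ∈ P, G.blockQuality γ (C \ (D ∪ S)) := by
  rw [quality_eq_sum, Leiden.move, Finset.sum_erase _ (G.blockQuality_empty γ)]
  have himg : ∑ C ∈ P.image (fun C => C \ (D ∪ S)), G.blockQuality γ C =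
      ∑ C ∈ P, G.blockQuality γ (C \ (D ∪ S)) := by
    refine Finset.sum_image_of_pairwise_eq_zero ?_
    intro C hC C' hC' hne h
    have hdis := hP.disjoint hC hC' hne
    have : C \ (D ∪ S) = ∅ := by
      rw [← Finset.disjoint_self_iff_empty]
      nth_rewrite 2 [h]
      exact hdis.mono Finset.sdiff_subset Finset.sdiff_subset
    rw [this, blockQuality_empty]
  -- The new community is disjoint from every remainder, so it can coincide with one only when it is
  -- empty.
  by_cases hmem : D ∪ S ∈ P.image fun C => C \ (D ∪ S)
  · obtain ⟨C, -, hC⟩ := Finset.mem_image.1 hmem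
    have : D ∪ S = ∅ := by
      rw [← Finset.disjoint_self_iff_empty]
      nth_rewrite 1 [← hC]
      exact Finset.sdiff_disjoint
    rw [Finset.insert_eq_of_mem hmem, himg]
    conv_rhs => rw [this, blockQuality_empty, zero_add]
    rw [this]
  · rw [Finset.sum_insert hmem, himg]

theorem move_of_subset (hP : IsNodePartition P) {S D : Finset W} (hD : D ∈ P) (hS : S ⊆ D) :
    Leiden.move P S D = P := by
  ext X
  rw [mem_move, Finset.union_eq_left.2 hS]
  constructor
  · rintro ⟨hX, rfl | ⟨C, hC, rfl⟩⟩
    · exact hD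
    · by_cases h : C = D
      · simp [h] at hX
      · rwa [Finset.sdiff_eq_self_of_disjoint (hP.disjoint hC hD h)]
  · intro hX
    refine ⟨(hP.nonempty X hX).ne_empty, ?_⟩
    by_cases h : X = D
    · exact Or.inl h
    · exact Or.inr ⟨X, hX, Finset.sdiff_eq_self_of_disjoint (hP.disjoint hX hD h)⟩

theorem gain_split (hP : IsNodePartition P) (G : Network W) (γ : ℝ) {S C : Finset W}
    (hC : C ∈ P) (hS : S ⊆ C) :
    gain G γ P S ∅ =
      G.blockQuality γ S + G.blockQuality γ (C \ S) - G.blockQuality γ C := by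
  rw [gain, hP.quality_move, quality_eq_sum, Finset.empty_union, ← Finset.add_sum_erase P _ hC,
    ← Finset.add_sum_erase P (G.blockQuality γ) hC]
  have : ∑ X ∈ P.erase C, G.blockQuality γ (X \ S) = ∑ X ∈ P.erase C, G.blockQuality γ X := by
    refine Finset.sum_congr rfl fun X hX => ?_
    rw [Finset.mem_erase] at hX
    rw [Finset.sdiff_eq_self_of_disjoint ((hP.disjoint hX.2 hC hX.1).mono_right hS)]
  rw [this]
  ring

theorem gain_split_eq_neg_cutGain (hP : IsNodePartition P) (G : Network W) (γ : ℝ)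
    {S C : Finset W} (hC : C ∈ P) (hS : S ⊆ C) :
    gain G γ P S ∅ = -G.cutGain γ S (C \ S) := by
  have h := G.blockQuality_union γ (Finset.disjoint_sdiff (s := S) (t := C))
  rw [Finset.union_sdiff_of_subset hS] at h
  rw [hP.gain_split G γ hC hS, h]
  ring

theorem gain_merge (hP : IsNodePartition P) (G : Network W) (γ : ℝ) {S D : Finset W}
    (hS : S ∈ P) (hD : D ∈ P) (hne : S ≠ D) :
    gain G γ P S D = G.cutGain γ S D := by
  have hD' : D ∈ P.erase S := Finset.mem_erase.2 ⟨hne.symm, hD⟩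
  rw [gain, hP.quality_move, quality_eq_sum, ← Finset.add_sum_erase P _ hS,
    ← Finset.add_sum_erase P (G.blockQuality γ) hS, ← Finset.add_sum_erase _ _ hD',
    ← Finset.add_sum_erase _ (G.blockQuality γ) hD']
  have : ∑ X ∈ (P.erase S).erase D, G.blockQuality γ (X \ (D ∪ S)) =
      ∑ X ∈ (P.erase S).erase D, G.blockQuality γ X := by
    refine Finset.sum_congr rfl fun X hX => ?_
    simp only [Finset.mem_erase] at hX
    rw [Finset.sdiff_eq_self_of_disjoint]
    exact Finset.disjoint_union_right.2
      ⟨hP.disjoint hX.2.2 hD hX.1, hP.disjoint hX.2.2 hS hX.2.1⟩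
  rw [this, Finset.sdiff_eq_empty_iff_subset.2 Finset.subset_union_right,
    Finset.sdiff_eq_empty_iff_subset.2 Finset.subset_union_left, blockQuality_empty,
    G.blockQuality_union γ (hP.disjoint hD hS hne.symm), cutGain_comm]
  ring

theorem sum_card (hP : IsNodePartition P) : ∑ C ∈ P, C.card = Fintype.card W := by
  rw [← Finset.card_biUnion fun C hC D hD h => hP.disjoint hC hD h, ← Finset.card_univ]
  congr 1
  ext v
  simpa using hP.exists_mem v

theorem card_lt (hP : IsNodePartition P) {C : Finset W} (hC : C ∈ P) (h : 1 < C.card) :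
    P.card < Fintype.card W := by
  rw [← hP.sum_card, Finset.card_eq_sum_ones]
  exact Finset.sum_lt_sum (fun D hD => Finset.card_pos.2 (hP.nonempty D hD)) ⟨C, hC, h⟩

theorem exists_one_lt_card (hP : IsNodePartition P) (h : P.card ≠ Fintype.card W) :
    ∃ C ∈ P, 1 < C.card := by
  by_contra! hle
  refine h ?_
  rw [← hP.sum_card, Finset.card_eq_sum_ones]
  exact Finset.sum_congr rfl fun C hC =>
    le_antisymm (Finset.card_pos.2 (hP.nonempty C hC)) (hle C hC)

end IsNodePartition

/-! ### Aggregation and flattening preserve the quality -/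

namespace IsNodePartition

variable {R P : Finset (Finset W)}

theorem exists_class (hR : IsNodePartition R) :
    ∃ f : W → R, ∀ v (C : R), v ∈ C.1 ↔ f v = C := by
  choose f hf hvf using hR.exists_mem
  refine ⟨fun v => ⟨f v, hf v⟩, fun v C => ⟨fun h => ?_, ?_⟩⟩
  · exact Subtype.ext (hR.eq_of_mem _ (hf v) _ C.2 v (hvf v) h)
  · rintro rfl
    exact hvf v

/-- Group the edges of `G` by their image under the class map `f`: the fibre over an aggregate edge
consists of exactly the edges whose weights it sums, self-loops included. -/
theorem aggregateGraph_E (hR : IsNodePartition R) (G : Network W) (X Y : Finset R) :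
    (aggregateGraph G R).E X Y = G.E (X.biUnion fun v => v.1) (Y.biUnion fun v => v.1) := by
  obtain ⟨f, hf⟩ := hR.exists_class
  symm
  unfold E
  rw [← Finset.sum_fiberwise_of_maps_to (g := Sym2.map f)
    (t := Finset.univ.filter fun e : Sym2 R => ∃ u ∈ X, ∃ v ∈ Y, e = s(u, v))]
  · refine Finset.sum_congr rfl fun e he => ?_
    simp only [Finset.mem_filter, Finset.mem_univ, true_and] at he
    obtain ⟨C, hC, D, hD, rfl⟩ := he
    change _ = ∑ e : Sym2 W with ∃ u ∈ C.1, ∃ v ∈ D.1, e = s(u, v), G.weight e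
    congr 1
    ext e
    simp only [Finset.mem_filter, Finset.mem_univ, true_and, Finset.mem_biUnion]
    constructor
    · rintro ⟨⟨u, -, v, -, rfl⟩, h⟩
      rw [Sym2.map_mk, Sym2.eq_iff] at h
      rcases h with ⟨h1, h2⟩ | ⟨h1, h2⟩
      · exact ⟨u, (hf u C).2 h1, v, (hf v D).2 h2, rfl⟩
      · exact ⟨v, (hf v C).2 h2, u, (hf u D).2 h1, Sym2.eq_swap⟩
    · rintro ⟨u, hu, v, hv, rfl⟩
      refine ⟨⟨u, ⟨C, hC, hu⟩, v, ⟨D, hD, hv⟩, rfl⟩, ?_⟩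
      rw [Sym2.map_mk, (hf u C).1 hu, (hf v D).1 hv]
  · intro e
    simp only [Finset.mem_filter, Finset.mem_univ, true_and, Finset.mem_biUnion]
    rintro ⟨u, ⟨C, hC, hu⟩, v, ⟨D, hD, hv⟩, rfl⟩
    exact ⟨C, hC, D, hD, by rw [Sym2.map_mk, (hf u C).1 hu, (hf v D).1 hv]⟩

theorem aggregateGraph_norm (hR : IsNodePartition R) (G : Network W) (X : Finset R) :
    (aggregateGraph G R).norm X = G.norm (X.biUnion fun v => v.1) := by
  unfold Network.norm
  rw [Finset.sum_biUnion]
  · rfl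
  · intro C _ D _ h
    exact hR.disjoint C.2 D.2 fun h' => h (Subtype.ext h')

theorem aggregateGraph_blockQuality (hR : IsNodePartition R) (G : Network W) (γ : ℝ)
    (X : Finset R) :
    (aggregateGraph G R).blockQuality γ X = G.blockQuality γ (X.biUnion fun v => v.1) := by
  rw [blockQuality, hR.aggregateGraph_E, hR.aggregateGraph_norm, blockQuality]

theorem biUnion_nonempty (hR : IsNodePartition R) {X : Finset R} (hX : X.Nonempty) :
    (X.biUnion fun v => v.1).Nonempty := by
  obtain ⟨C, hC⟩ := hX
  obtain ⟨v, hv⟩ := hR.nonempty C.1 C.2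
  exact ⟨v, Finset.mem_biUnion.2 ⟨C, hC, hv⟩⟩

theorem eq_of_mem_biUnion (hR : IsNodePartition R) {Q : Finset (Finset R)}
    (hQ : IsNodePartition Q) {X Y : Finset R} (hX : X ∈ Q) (hY : Y ∈ Q) {v : W}
    (hvX : v ∈ X.biUnion fun v => v.1) (hvY : v ∈ Y.biUnion fun v => v.1) : X = Y := by
  obtain ⟨C, hC, hvC⟩ := Finset.mem_biUnion.1 hvX
  obtain ⟨D, hD, hvD⟩ := Finset.mem_biUnion.1 hvY
  obtain rfl : C = D := Subtype.ext (hR.eq_of_mem _ C.2 _ D.2 v hvC hvD)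
  exact hQ.eq_of_mem _ hX _ hY C hC hD

theorem flattenPartition (hR : IsNodePartition R) {Q : Finset (Finset R)}
    (hQ : IsNodePartition Q) : IsNodePartition (flattenPartition Q) where
  nonempty C hC := by
    obtain ⟨X, hX, rfl⟩ := Finset.mem_image.1 hC
    exact hR.biUnion_nonempty (hQ.nonempty X hX)
  exists_mem v := by
    obtain ⟨C, hC, hv⟩ := hR.exists_mem v
    obtain ⟨X, hX, hCX⟩ := hQ.exists_mem ⟨C, hC⟩
    exact ⟨_, Finset.mem_image_of_mem _ hX, Finset.mem_biUnion.2 ⟨_, hCX, hv⟩⟩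
  eq_of_mem C hC D hD v hvC hvD := by
    obtain ⟨X, hX, rfl⟩ := Finset.mem_image.1 hC
    obtain ⟨Y, hY, rfl⟩ := Finset.mem_image.1 hD
    rw [hR.eq_of_mem_biUnion hQ hX hY hvC hvD]

theorem quality_flattenPartition (hR : IsNodePartition R) {Q : Finset (Finset R)}
    (hQ : IsNodePartition Q) (G : Network W) (γ : ℝ) :
    G.quality γ (Leiden.flattenPartition Q) = (aggregateGraph G R).quality γ Q := by
  rw [quality_eq_sum, quality_eq_sum, Leiden.flattenPartition, Finset.sum_image]
  · exact Finset.sum_congr rfl fun X _ => (hR.aggregateGraph_blockQuality G γ X).symm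
  · intro X hX Y hY h
    dsimp only at h
    obtain ⟨v, hv⟩ := hR.biUnion_nonempty (hQ.nonempty X hX)
    exact hR.eq_of_mem_biUnion hQ hX hY hv (h ▸ hv)

theorem biUnion_filter_subset (hR : IsNodePartition R) (hP : IsNodePartition P)
    (hRP : ∀ A ∈ R, ∃ C ∈ P, A ⊆ C) {C : Finset W} (hC : C ∈ P) :
    ((Finset.univ.filter fun v : R => v.1 ⊆ C).biUnion fun v => v.1) = C := by
  ext v
  simp only [Finset.mem_biUnion, Finset.mem_filter, Finset.mem_univ, true_and]
  constructor
  · rintro ⟨A, hA, hv⟩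
    exact hA hv
  · intro hv
    obtain ⟨A, hA, hvA⟩ := hR.exists_mem v
    obtain ⟨D, hD, hAD⟩ := hRP A hA
    obtain rfl := hP.eq_of_mem _ hC _ hD v hv (hAD hvA)
    exact ⟨⟨A, hA⟩, hAD, hvA⟩

theorem flattenPartition_aggregatePartition (hR : IsNodePartition R) (hP : IsNodePartition P)
    (hRP : ∀ A ∈ R, ∃ C ∈ P, A ⊆ C) :
    Leiden.flattenPartition (aggregatePartition R P) = P := by
  rw [Leiden.flattenPartition, aggregatePartition, Finset.image_image]
  refine (Finset.image_congr fun C hC => ?_).trans Finset.image_id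
  exact hR.biUnion_filter_subset hP hRP hC

theorem aggregatePartition (hR : IsNodePartition R) (hP : IsNodePartition P)
    (hRP : ∀ A ∈ R, ∃ C ∈ P, A ⊆ C) : IsNodePartition (aggregatePartition R P) where
  nonempty X hX := by
    obtain ⟨C, hC, rfl⟩ := Finset.mem_image.1 hX
    rw [Finset.nonempty_iff_ne_empty]
    intro h
    have := hR.biUnion_filter_subset hP hRP hC
    rw [h, Finset.biUnion_empty] at this
    exact hP.empty_notMem (this ▸ hC)
  exists_mem A := by
    obtain ⟨C, hC, hAC⟩ := hRP A.1 A.2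
    exact ⟨_, Finset.mem_image_of_mem _ hC, by simpa using hAC⟩
  eq_of_mem X hX Y hY A hAX hAY := by
    obtain ⟨C, hC, rfl⟩ := Finset.mem_image.1 hX
    obtain ⟨D, hD, rfl⟩ := Finset.mem_image.1 hY
    simp only [Finset.mem_filter, Finset.mem_univ, true_and] at hAX hAY
    obtain ⟨v, hv⟩ := hR.nonempty A.1 A.2
    rw [hP.eq_of_mem C hC D hD v (hAX hv) (hAY hv)]

theorem quality_aggregatePartition (hR : IsNodePartition R) (hP : IsNodePartition P)
    (hRP : ∀ A ∈ R, ∃ C ∈ P, A ⊆ C) (G : Network W) (γ : ℝ) :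
    (aggregateGraph G R).quality γ (Leiden.aggregatePartition R P) = G.quality γ P := by
  rw [← hR.quality_flattenPartition (hR.aggregatePartition hP hRP),
    hR.flattenPartition_aggregatePartition hP hRP]

/-- Splitting off a node of the aggregate graph changes the quality by as much as splitting off
the corresponding set of nodes. -/
theorem gain_aggregate_split (hR : IsNodePartition R) (hP : IsNodePartition P)
    (hRP : ∀ A ∈ R, ∃ C ∈ P, A ⊆ C) (G : Network W) (γ : ℝ) {T : R} {C : Finset W} (hC : C ∈ P)
    (hT : T.1 ⊆ C) :
    gain (aggregateGraph G R) γ (Leiden.aggregatePartition R P) {T} ∅ =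
      -G.cutGain γ T.1 (C \ T.1) := by
  have hX : (Finset.univ.filter fun v : R => v.1 ⊆ C) ∈ Leiden.aggregatePartition R P :=
    Finset.mem_image_of_mem _ hC
  have hTX : {T} ⊆ (Finset.univ.filter fun v : R => v.1 ⊆ C) := by simpa using hT
  -- Members of `R` are disjoint, so deleting the node `T` deletes exactly the elements of `T.1`
  -- from the union.
  have hdiff : (((Finset.univ.filter fun v : R => v.1 ⊆ C) \ {T}).biUnion fun v => v.1) =
      C \ T.1 := by
    conv_rhs => rw [← hR.biUnion_filter_subset hP hRP hC]
    ext v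
    simp only [Finset.mem_biUnion, Finset.mem_sdiff, Finset.mem_singleton]
    constructor
    · rintro ⟨A, ⟨hA, hne⟩, hv⟩
      exact ⟨⟨A, hA, hv⟩, fun hvT =>
        hne (Subtype.ext (hR.eq_of_mem _ A.2 _ T.2 v hv hvT))⟩
    · rintro ⟨⟨A, hA, hv⟩, hvT⟩
      exact ⟨A, ⟨hA, by rintro rfl; exact hvT hv⟩, hv⟩
  have h := G.blockQuality_union γ (Finset.disjoint_sdiff (s := T.1) (t := C))
  rw [Finset.union_sdiff_of_subset hT] at h
  rw [(hR.aggregatePartition hP hRP).gain_split _ γ hX hTX, hR.aggregateGraph_blockQuality,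
    hR.aggregateGraph_blockQuality, hR.aggregateGraph_blockQuality, hdiff,
    hR.biUnion_filter_subset hP hRP hC, Finset.singleton_biUnion, h]
  ring

end IsNodePartition

/-! ### Termination of fast local moving -/

/-- The qualities above `h` that a partition of the nodes can have. -/
noncomputable def qualitiesAbove (G : Network W) (γ h : ℝ) : Finset ℝ :=
  ((Finset.univ.filter fun P : Finset (Finset W) => IsNodePartition P).image
    (G.quality γ)).filter (h < ·)

theorem mem_qualitiesAbove {G : Network W} {γ h x : ℝ} :
    x ∈ qualitiesAbove G γ h ↔ (∃ P, IsNodePartition P ∧ G.quality γ P = x) ∧ h < x := by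
  simp [qualitiesAbove]

theorem card_qualitiesAbove_lt {G : Network W} {γ h : ℝ} {P : Finset (Finset W)}
    (hP : IsNodePartition P) (h' : h < G.quality γ P) :
    (qualitiesAbove G γ (G.quality γ P)).card < (qualitiesAbove G γ h).card := by
  refine Finset.card_lt_card ((Finset.ssubset_iff_of_subset fun x hx => ?_).2
    ⟨G.quality γ P, mem_qualitiesAbove.2 ⟨⟨P, hP, rfl⟩, h'⟩, fun hx => ?_⟩)
  · rw [mem_qualitiesAbove] at hx ⊢
    exact ⟨hx.1, h'.trans hx.2⟩
  · exact lt_irrefl _ (mem_qualitiesAbove.1 hx).2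

/-- Flattening realizes every quality of the aggregate graph in `G`, so this part of the termination
measure survives aggregation. -/
theorem card_qualitiesAbove_aggregateGraph_le {R : Finset (Finset W)} (hR : IsNodePartition R)
    (G : Network W) (γ h : ℝ) :
    (qualitiesAbove (aggregateGraph G R) γ h).card ≤ (qualitiesAbove G γ h).card := by
  refine Finset.card_le_card fun x hx => ?_
  rw [mem_qualitiesAbove] at hx ⊢
  obtain ⟨⟨Q, hQ, rfl⟩, hx⟩ := hx
  exact ⟨⟨_, hR.flattenPartition hQ, hR.quality_flattenPartition hQ G γ⟩, hx⟩

/-- A profitable move may lengthen the queue but uses up one of the finitely many higher qualities;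
any other step shortens the queue. Hence the lexicographic induction. If nothing moved, every queued
node was tested against the same partition `P`. -/
theorem IsNodePartition.exists_moveLoop {γ : ℝ} (π : Policy.{u} γ) (G : Network W) (n : ℕ) :
    ∀ (P : Finset (Finset W)) (q : List W), IsNodePartition P →
      (qualitiesAbove G γ (G.quality γ P)).card ≤ n →
      ∃ P', MoveLoop π G P q P' ∧ IsNodePartition P' ∧
        (P' = P ∧ (∀ v ∈ q, gain G γ P {v} (π.best G P v) ≤ 0) ∨
          G.quality γ P < G.quality γ P') := by
  induction n using Nat.strong_induction_on with
  | _ n ihn =>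
    intro P q hP hn
    induction q with
    | nil => exact ⟨P, .done P, hP, Or.inl ⟨rfl, by simp⟩⟩
    | cons v q ih =>
      by_cases h : 0 < gain G γ P {v} (π.best G P v)
      · have hm := hP.move {v} (π.best G P v)
        obtain ⟨P', hl, hP', h'⟩ := ihn _
          ((card_qualitiesAbove_lt (G := G) (γ := γ) hm (sub_pos.1 h)).trans_le hn) _
          (q ++ π.enum (outsideNeighbours G v (π.best G P v ∪ {v}) \ q.toFinset)) hm le_rfl
        refine ⟨P', .move h hl, hP', Or.inr ?_⟩
        rcases h' with ⟨rfl, -⟩ | h'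
        · exact sub_pos.1 h
        · exact (sub_pos.1 h).trans h'
      · obtain ⟨P', hl, hP', h'⟩ := ih
        refine ⟨P', .stay h hl, hP', h'.imp_left ?_⟩
        rintro ⟨h1, h2⟩
        exact ⟨h1, by simpa using ⟨not_lt.1 h, h2⟩⟩

theorem moveLoop_self {γ : ℝ} (π : Policy.{u} γ) (G : Network W) {P : Finset (Finset W)}
    (hstab : ∀ v, gain G γ P {v} (π.best G P v) ≤ 0) (q : List W) : MoveLoop π G P q P := by
  induction q with
  | nil => exact .done P
  | cons v q ih => exact .stay (not_lt.2 (hstab v)) ih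

theorem IsNodePartition.exists_moveNodesFast {γ : ℝ} (π : Policy.{u} γ) (G : Network W)
    {P : Finset (Finset W)} (hP : IsNodePartition P) :
    ∃ P', MoveNodesFast π G P P' ∧ IsNodePartition P' ∧
      (P' = P ∧ (∀ v, gain G γ P {v} (π.best G P v) ≤ 0) ∨
        G.quality γ P < G.quality γ P') := by
  obtain ⟨P', h, hP', h'⟩ := exists_moveLoop π G _ P Finset.univ.toList hP le_rfl
  exact ⟨P', ⟨_, Finset.nodup_toList _, by simp, h⟩, hP', by simpa using h'⟩

/-! ### Refinements that occur with positive probability -/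

/-- The partition whose only nontrivial community is `A`. -/
def mergedPartition (A : Finset W) : Finset (Finset W) :=
  insert A (Aᶜ.image fun v => {v})

theorem mem_mergedPartition {A X : Finset W} :
    X ∈ mergedPartition A ↔ X = A ∨ ∃ v ∉ A, {v} = X := by
  simp [mergedPartition]

theorem isNodePartition_mergedPartition {A : Finset W} (hA : A.Nonempty) :
    IsNodePartition (mergedPartition A) where
  nonempty X hX := by
    rcases mem_mergedPartition.1 hX with rfl | ⟨v, -, rfl⟩
    · exact hA
    · exact Finset.singleton_nonempty v
  exists_mem v := by
    by_cases hv : v ∈ A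
    · exact ⟨A, mem_mergedPartition.2 (Or.inl rfl), hv⟩
    · exact ⟨{v}, mem_mergedPartition.2 (Or.inr ⟨v, hv, rfl⟩), by simp⟩
  eq_of_mem X hX Y hY v hvX hvY := by
    rcases mem_mergedPartition.1 hX with rfl | ⟨x, hx, rfl⟩ <;>
    rcases mem_mergedPartition.1 hY with rfl | ⟨y, hy, rfl⟩ <;> grind

theorem mergedPartition_singleton (v : W) : mergedPartition {v} = singletonPartition W := by
  ext X
  rw [mem_mergedPartition]
  simp only [singletonPartition, Finset.mem_image, Finset.mem_univ, true_and,
    Finset.mem_singleton]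
  constructor
  · rintro (rfl | ⟨v, -, rfl⟩) <;> exact ⟨_, rfl⟩
  · rintro ⟨w, rfl⟩
    by_cases h : w = v
    · exact Or.inl (by rw [h])
    · exact Or.inr ⟨w, h, rfl⟩

theorem isNodePartition_singletonPartition : IsNodePartition (singletonPartition W) where
  nonempty X hX := by
    obtain ⟨v, -, rfl⟩ := Finset.mem_image.1 hX
    exact Finset.singleton_nonempty v
  exists_mem v := ⟨{v}, Finset.mem_image_of_mem _ (Finset.mem_univ v), by simp⟩
  eq_of_mem X hX Y hY v hvX hvY := by
    obtain ⟨x, -, rfl⟩ := Finset.mem_image.1 hX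
    obtain ⟨y, -, rfl⟩ := Finset.mem_image.1 hY
    rw [← Finset.mem_singleton.1 hvX, ← Finset.mem_singleton.1 hvY]

theorem move_mergedPartition {A : Finset W} (hA : A.Nonempty) (v : W) :
    move (mergedPartition A) {v} A = mergedPartition (insert v A) := by
  have hu : A ∪ {v} = insert v A := by rw [Finset.union_comm, ← Finset.insert_eq]
  ext X
  rw [IsNodePartition.mem_move, hu, mem_mergedPartition]
  constructor
  · rintro ⟨hX, rfl | ⟨C, hC, rfl⟩⟩
    · exact Or.inl rfl
    · rcases mem_mergedPartition.1 hC with rfl | ⟨w, hw, rfl⟩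
      · exact absurd (Finset.sdiff_eq_empty_iff_subset.2 (Finset.subset_insert v _)) hX
      · by_cases h : w ∈ insert v A
        · simp [h] at hX
        · refine Or.inr ⟨w, h, (Finset.sdiff_eq_self_of_disjoint ?_).symm⟩
          exact Finset.disjoint_singleton_left.2 h
  · rintro (rfl | ⟨w, hw, rfl⟩)
    · exact ⟨by simp, Or.inl rfl⟩
    · refine ⟨by simp, Or.inr ⟨{w}, mem_mergedPartition.2 (Or.inr ⟨w, ?_, rfl⟩), ?_⟩⟩
      · exact fun h => hw (Finset.mem_insert_of_mem h)
      · simp [hw]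

variable {G : Network W} {γ θ : ℝ}

theorem mergeWeight_nonneg (P : Finset (Finset W)) (v : W) (C : Finset W) :
    0 ≤ mergeWeight G γ θ P v C := by
  unfold mergeWeight
  split_ifs <;> positivity

theorem mergeProb_pos {S : Finset W} {P : Finset (Finset W)} {v : W} {C : Finset W}
    (hC : C ∈ mergeTargets G γ S P) (h : 0 ≤ gain G γ P {v} C) :
    0 < mergeProb G γ θ S P v C := by
  have hpos : 0 < mergeWeight G γ θ P v C := by
    rw [mergeWeight, if_pos h]
    exact Real.exp_pos _
  rw [mergeProb, if_pos hC]
  exact div_pos hpos (hpos.trans_le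
    (Finset.single_le_sum (fun D _ => mergeWeight_nonneg P v D) hC))

/-- A visited well connected singleton is among its own merge targets. Choosing it has gain 0 and
hence positive probability, and changes nothing. -/
theorem IsNodePartition.mergeLoop_self {R : Finset (Finset W)} (hR : IsNodePartition R)
    (S : Finset W) (l : List W) (hl : ∀ v ∈ l, v ∈ wellConnectedNodes G γ S) :
    MergeLoop G γ θ S R l R := by
  induction l with
  | nil => exact .done R
  | cons v l ih =>
    rw [List.forall_mem_cons] at hl
    by_cases hv : {v} ∈ R
    · have hmove : Leiden.move R {v} {v} = R := hR.move_of_subset hv subset_rfl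
      have hw := Finset.mem_filter.1 hl.1
      refine .merge {v} hv (mergeProb_pos ?_ ?_) ?_
      · exact Finset.mem_filter.2 ⟨hv, by simpa using hw.1, hw.2⟩
      · rw [gain, hmove, sub_self]
      · rw [hmove]
        exact ih hl.2
    · exact .skip hv (ih hl.2)

theorem IsNodePartition.mergeNodesSubset_self {R : Finset (Finset W)} (hR : IsNodePartition R)
    (S : Finset W) : MergeNodesSubset G γ θ R S R :=
  ⟨(wellConnectedNodes G γ S).toList, Finset.nodup_toList _, by simp,
    hR.mergeLoop_self S _ (by simp)⟩

theorem IsNodePartition.refineLoop_self {R : Finset (Finset W)} (hR : IsNodePartition R)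
    (l : List (Finset W)) : RefineLoop G γ θ R l R := by
  induction l with
  | nil => exact .done R
  | cons C l ih => exact .next (hR.mergeNodesSubset_self C) ih

theorem refinePartition_singletonPartition (P : Finset (Finset W)) :
    RefinePartition G γ θ P (singletonPartition W) :=
  ⟨P.toList, Finset.nodup_toList _, by simp, isNodePartition_singletonPartition.refineLoop_self _⟩

theorem MergeLoop.append {S : Finset W} {P P' P'' : Finset (Finset W)} {l l' : List W}
    (h : MergeLoop G γ θ S P l P') (h' : MergeLoop G γ θ S P' l' P'') :
    MergeLoop G γ θ S P (l ++ l') P'' := by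
  induction h with
  | done P => exact h'
  | skip h _ ih => exact .skip h (ih h')
  | merge C h hC _ ih => exact .merge C h hC (ih h')

/-- The current set `A` is an admissible target by `hwell`, and `hgrow` gives the next node to
visit; the induction is on the number of nodes of `T` still missing. -/
theorem exists_mergeLoop {C T : Finset W} (hTC : T ⊆ C)
    (hwell : ∀ A ⊂ T, A.Nonempty → WellConnected G γ C A)
    (hgrow : ∀ A ⊂ T, A.Nonempty → ∃ v ∈ T \ A, 0 ≤ G.cutGain γ {v} A) (n : ℕ) :
    ∀ A ⊆ T, A.Nonempty → (T \ A).card = n →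
      ∃ l : List W, l.Nodup ∧ (∀ v ∈ l, v ∈ T \ A) ∧
        MergeLoop G γ θ C (mergedPartition A) l (mergedPartition T) := by
  induction n with
  | zero =>
    intro A hA _ hn
    obtain rfl := hA.antisymm (Finset.sdiff_eq_empty_iff_subset.1 (Finset.card_eq_zero.1 hn))
    exact ⟨[], List.nodup_nil, by simp, .done _⟩
  | succ n ih =>
    intro A hA hne hn
    have hss : A ⊂ T := hA.ssubset_of_ne (by rintro rfl; simp at hn)
    obtain ⟨v, hv, hgain⟩ := hgrow A hss hne
    have hv' := Finset.mem_sdiff.1 hv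
    obtain ⟨l, hl, hlT, hloop⟩ := ih (insert v A) (Finset.insert_subset hv'.1 hA)
      (Finset.insert_nonempty _ _) (by
        rw [Finset.sdiff_insert, Finset.card_erase_of_mem hv, hn, Nat.add_sub_cancel])
    refine ⟨v :: l, List.nodup_cons.2 ⟨fun h => ?_, hl⟩, ?_, ?_⟩
    · simpa using hlT v h
    · intro w hw
      rcases List.mem_cons.1 hw with rfl | hw
      · exact hv
      · have := hlT w hw
        simp only [Finset.mem_sdiff, Finset.mem_insert, not_or] at this ⊢
        exact ⟨this.1, this.2.2⟩
    · have hsing : {v} ∈ mergedPartition A := mem_mergedPartition.2 (Or.inr ⟨v, hv'.2, rfl⟩)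
      have hmem : A ∈ mergedPartition A := mem_mergedPartition.2 (Or.inl rfl)
      refine .merge A hsing (mergeProb_pos ?_ ?_) ?_
      · exact Finset.mem_filter.2 ⟨hmem, hA.trans hTC, hwell A hss hne⟩
      · rwa [(isNodePartition_mergedPartition hne).gain_merge G γ hsing hmem]
        rintro rfl
        simp at hv'
      · rwa [move_mergedPartition hne]

/-- A set that can be grown node by node from any of its nonempty subsets without decreasing the
quality, through well connected subsets, is a community of a possible refinement. -/
theorem refinePartition_mergedPartition {P : Finset (Finset W)} {C T : Finset W} (hC : C ∈ P)
    (hTC : T ⊆ C) (hT : T.Nonempty) (hwell : ∀ A ⊂ T, A.Nonempty → WellConnected G γ C A)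
    (hgrow : ∀ A ⊂ T, A.Nonempty → ∃ v ∈ T \ A, 0 ≤ G.cutGain γ {v} A) :
    RefinePartition G γ θ P (mergedPartition T) := by
  obtain ⟨v, hv⟩ := hT
  obtain ⟨l, hl, hlT, hloop⟩ := exists_mergeLoop (θ := θ) hTC hwell hgrow _ {v}
    (by simpa using hv) (Finset.singleton_nonempty v) rfl
  -- A node `w` of `l` differs from the seed `v`, so `{w}` is a proper subset of `T` and `hwell`
  -- applies.
  have hlW : ∀ w ∈ l, w ∈ wellConnectedNodes G γ C := by
    intro w hw
    have hwT := Finset.mem_sdiff.1 (hlT w hw)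
    refine Finset.mem_filter.2 ⟨hTC hwT.1, hwell {w} ?_ (Finset.singleton_nonempty w)⟩
    refine (Finset.ssubset_iff_of_subset (by simpa using hwT.1)).2 ⟨v, hv, ?_⟩
    simpa [eq_comm] using hwT.2
  have hpart := isNodePartition_mergedPartition ⟨v, hv⟩
  -- The random order may put `C` first; afterwards every community can be left as it is.
  refine ⟨C :: (P.erase C).toList, ?_, ?_, .next (R₁ := mergedPartition T) ?_
    (hpart.refineLoop_self _)⟩
  · exact List.nodup_cons.2 ⟨by simp, Finset.nodup_toList _⟩
  · intro D
    by_cases h : D = C <;> simp [h, hC]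
  -- Once `T` is built, the remaining well connected nodes are skipped or choose their own
  -- singleton.
  · refine ⟨l ++ (wellConnectedNodes G γ C \ l.toFinset).toList, ?_, ?_, ?_⟩
    · refine List.Nodup.append hl (Finset.nodup_toList _) ?_
      intro w hw hw'
      simp [hw] at hw'
    · intro w
      by_cases h : w ∈ l <;> simp [h, hlW]
    · rw [← mergedPartition_singleton v]
      exact hloop.append (hpart.mergeLoop_self C _ fun w hw => by
        rw [Finset.mem_toList, Finset.mem_sdiff] at hw
        exact hw.1)

theorem exists_superset_of_mem_mergedPartition {P : Finset (Finset W)} (hP : IsNodePartition P)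
    {C T : Finset W} (hC : C ∈ P) (hTC : T ⊆ C) : ∀ A ∈ mergedPartition T, ∃ D ∈ P, A ⊆ D := by
  intro A hA
  rcases mem_mergedPartition.1 hA with rfl | ⟨v, -, rfl⟩
  · exact ⟨C, hC, hTC⟩
  · simpa using hP.exists_mem v

theorem exists_superset_of_mem_singletonPartition {P : Finset (Finset W)}
    (hP : IsNodePartition P) : ∀ A ∈ singletonPartition W, ∃ D ∈ P, A ⊆ D := by
  intro A hA
  obtain ⟨v, -, rfl⟩ := Finset.mem_image.1 hA
  simpa using hP.exists_mem v

theorem card_singletonPartition : (singletonPartition W).card = Fintype.card W := by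
  rw [singletonPartition, Finset.card_image_of_injective _ Finset.singleton_injective,
    Finset.card_univ]

/-! ### Completing an iteration without losing quality -/

theorem IsNodePartition.wellConnected_singleton {π : Policy.{u} γ} {P : Finset (Finset W)}
    (hP : IsNodePartition P) (hstab : ∀ v, gain G γ P {v} (π.best G P v) ≤ 0) {C : Finset W}
    (hC : C ∈ P) {v : W} (hv : v ∈ C) : 0 ≤ G.cutGain γ {v} (C \ {v}) := by
  have h := (π.gain_le_best G P v ∅ (Finset.mem_insert_self _ _)).trans (hstab v)
  rw [hP.gain_split_eq_neg_cutGain G γ hC (by simpa using hv)] at h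
  linarith

/-- If no single node can be moved with profit, then some refinement merges two nodes. -/
theorem IsNodePartition.exists_refinePartition_card_lt {π : Policy.{u} γ}
    {P : Finset (Finset W)} (hP : IsNodePartition P)
    (hstab : ∀ v, gain G γ P {v} (π.best G P v) ≤ 0) (hcard : P.card ≠ Fintype.card W) :
    ∃ R, RefinePartition G γ θ P R ∧ IsNodePartition R ∧ (∀ A ∈ R, ∃ C ∈ P, A ⊆ C) ∧
      R.card < Fintype.card W := by
  obtain ⟨C, hC, hC1⟩ := hP.exists_one_lt_card hcard
  obtain ⟨v, hv, w, hw, hvw⟩ := Finset.one_lt_card.1 hC1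
  -- The gains g(u, v) over the other nodes u of `C` sum to g(v, C - v), which is nonnegative; they
  -- cannot all be negative.
  obtain ⟨u, hu, hgain⟩ : ∃ u ∈ C \ {v}, 0 ≤ G.cutGain γ {u} {v} := by
    by_contra! hneg
    have h := hP.wellConnected_singleton hstab hC hv
    rw [cutGain_comm, cutGain_eq_sum _ _ Finset.sdiff_disjoint] at h
    exact absurd h (not_le.2 (Finset.sum_neg hneg
      ⟨w, Finset.mem_sdiff.2 ⟨hw, by simpa using hvw.symm⟩⟩))
  have huC := (Finset.mem_sdiff.1 hu).1
  have huv : u ≠ v := by simpa using (Finset.mem_sdiff.1 hu).2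
  have hTC : {u, v} ⊆ C := Finset.insert_subset huC (by simpa using hv)
  have hT : ({u, v} : Finset W).Nonempty := Finset.insert_nonempty _ _
  have hsub : ∀ A ⊂ ({u, v} : Finset W), A.Nonempty → A = {u} ∨ A = {v} := by
    intro A hA hne
    have h := hA.subset
    rw [← Finset.coe_subset, Finset.coe_pair, Set.subset_pair_iff_eq] at h
    rcases h with h | h | h | h
    · exact absurd (Finset.coe_eq_empty.1 h) hne.ne_empty
    · exact Or.inl (Finset.coe_eq_singleton.1 h)
    · exact Or.inr (Finset.coe_eq_singleton.1 h)
    · exact absurd (Finset.coe_injective (h.trans (Finset.coe_pair).symm)) hA.ne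
  refine ⟨mergedPartition {u, v}, refinePartition_mergedPartition hC hTC hT ?_ ?_,
    isNodePartition_mergedPartition hT, exists_superset_of_mem_mergedPartition hP hC hTC,
    (isNodePartition_mergedPartition hT).card_lt (mem_mergedPartition.2 (Or.inl rfl)) ?_⟩
  · intro A hA hne
    rcases hsub A hA hne with rfl | rfl
    · exact (wellConnected_iff G γ (by simpa using huC)).2
        (hP.wellConnected_singleton hstab hC huC)
    · exact (wellConnected_iff G γ (by simpa using hv)).2
        (hP.wellConnected_singleton hstab hC hv)
  · intro A hA hne
    rcases hsub A hA hne with rfl | rfl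
    · exact ⟨v, by simp [huv.symm], by rwa [cutGain_comm]⟩
    · exact ⟨u, by simp [huv], hgain⟩
  · rw [Finset.card_pair huv]
    exact one_lt_two

/-- The algorithm can terminate from every partition, and it does not decrease the quality. -/
theorem exists_leidenStep_of_card_le (π : Policy.{u} γ) (θ : ℝ) (n : ℕ) :
    ∀ {W : Type u} [Fintype W] [DecidableEq W] (G : Network W) (P : Finset (Finset W)),
      IsNodePartition P → (qualitiesAbove G γ (G.quality γ P)).card + Fintype.card W ≤ n →
      ∃ Q, LeidenStep π θ G P Q ∧ IsNodePartition Q ∧ G.quality γ P ≤ G.quality γ Q := by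
  induction n using Nat.strong_induction_on with
  | _ n ih =>
    intro W _ _ G P hP hn
    obtain ⟨P₁, hmove, hP₁, h⟩ := hP.exists_moveNodesFast π G
    have hle : G.quality γ P ≤ G.quality γ P₁ := by
      rcases h with ⟨rfl, -⟩ | h
      · exact le_rfl
      · exact h.le
    by_cases hcard : P₁.card = Fintype.card W
    · exact ⟨P₁, .finish hmove hcard, hP₁, hle⟩
    -- The measure drops either way. If local moving changed nothing, a refinement merging two nodes
    -- reduces the node count; if it raised the quality, fewer higher qualities remain and the
    -- singleton refinement suffices.
    obtain ⟨R, hrefine, hR, hRP, hlt⟩ : ∃ R, RefinePartition G γ θ P₁ R ∧ IsNodePartition R ∧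
        (∀ A ∈ R, ∃ C ∈ P₁, A ⊆ C) ∧
        (qualitiesAbove G γ (G.quality γ P₁)).card + R.card < n := by
      rcases h with ⟨rfl, hstab⟩ | h
      · obtain ⟨R, h1, h2, h3, h4⟩ :=
          hP₁.exists_refinePartition_card_lt (θ := θ) hstab hcard
        exact ⟨R, h1, h2, h3, by omega⟩
      · refine ⟨_, refinePartition_singletonPartition P₁, isNodePartition_singletonPartition,
          exists_superset_of_mem_singletonPartition hP₁, ?_⟩
        have := card_qualitiesAbove_lt hP₁ h
        rw [card_singletonPartition]
        omega
    have hq := hR.quality_aggregatePartition hP₁ hRP G γ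
    have hagg := card_qualitiesAbove_aggregateGraph_le hR G γ (G.quality γ P₁)
    obtain ⟨Q, hQ, hQpart, hQle⟩ := ih _ hlt (aggregateGraph G R) (aggregatePartition R P₁)
      (hR.aggregatePartition hP₁ hRP) (by
        rw [hq, Fintype.card_coe]
        omega)
    refine ⟨_, .level hmove hcard hrefine hQ, hR.flattenPartition hQpart, ?_⟩
    rw [hR.quality_flattenPartition hQpart]
    exact hle.trans (hq.ge.trans hQle)

theorem IsNodePartition.exists_leidenStep (π : Policy.{u} γ) (θ : ℝ) (G : Network W)
    {P : Finset (Finset W)} (hP : IsNodePartition P) :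
    ∃ Q, LeidenStep π θ G P Q ∧ IsNodePartition Q ∧ G.quality γ P ≤ G.quality γ Q :=
  exists_leidenStep_of_card_le π θ _ G P hP le_rfl

/-- A profitable node rules out that local moving leaves `P` unchanged, so the quality rises there,
and the rest of the run can be chosen not to lower it. -/
theorem IsNodePartition.exists_leidenStep_quality_lt (π : Policy.{u} γ) (θ : ℝ) (G : Network W)
    {P : Finset (Finset W)} (hP : IsNodePartition P) {v : W}
    (hv : 0 < gain G γ P {v} (π.best G P v)) :
    ∃ Q, LeidenStep π θ G P Q ∧ IsNodePartition Q ∧ G.quality γ P < G.quality γ Q := by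
  obtain ⟨P₁, hmove, hP₁, ⟨-, h⟩ | hlt⟩ := hP.exists_moveNodesFast π G
  · exact absurd (h v) (not_le.2 hv)
  by_cases hcard : P₁.card = Fintype.card W
  · exact ⟨P₁, .finish hmove hcard, hP₁, hlt⟩
  have hR := isNodePartition_singletonPartition (W := W)
  have hRP := exists_superset_of_mem_singletonPartition hP₁
  obtain ⟨Q, hQ, hQpart, hQle⟩ := (hR.aggregatePartition hP₁ hRP).exists_leidenStep π θ
    (aggregateGraph G (singletonPartition W))
  refine ⟨_, .level hmove hcard (refinePartition_singletonPartition P₁) hQ,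
    hR.flattenPartition hQpart, ?_⟩
  rw [hR.quality_flattenPartition hQpart]
  rw [hR.quality_aggregatePartition hP₁ hRP] at hQle
  exact hlt.trans_le hQle

/-! ### Consequences of asymptotic stability -/

/-- Stability speaks of infinite sequences, so the single step from `P` to `Q` is prolonged by
iterating a chosen successor from `Q`. Stability at time 1 then forces `Q = P`. -/
theorem AsymptoticallyStable.quality_le {π : Policy.{u} γ} {P Q : Finset (Finset W)}
    (hstab : AsymptoticallyStable π θ G P) (hPQ : LeidenStep π θ G P Q)
    (hQ : IsNodePartition Q) : G.quality γ Q ≤ G.quality γ P := by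
  choose next hnext hpart _ using fun P : {P : Finset (Finset W) // IsNodePartition P} =>
    P.2.exists_leidenStep π θ G
  let orbit : ℕ → {P : Finset (Finset W) // IsNodePartition P} :=
    fun n => (fun P => ⟨next P, hpart P⟩)^[n] ⟨Q, hQ⟩
  have h := hstab (fun n => Nat.casesOn n P fun n => (orbit n).1) 0 (fun n => ?_) rfl 1
    (Nat.zero_le 1)
  · exact (congrArg (G.quality γ) h).le
  · cases n with
    | zero => exact hPQ
    | succ n =>
      change LeidenStep π θ G (orbit n).1 (orbit (n + 1)).1
      have : orbit (n + 1) = ⟨next (orbit n), hpart (orbit n)⟩ :=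
        Function.iterate_succ_apply' _ _ _
      rw [this]
      exact hnext (orbit n)

theorem AsymptoticallyStable.cutGain_nonneg {π : Policy.{u} γ} {P : Finset (Finset W)}
    (hP : IsNodePartition P) (hstab : AsymptoticallyStable π θ G P) {C : Finset W} (hC : C ∈ P)
    {S : Finset W} (hS : S ⊆ C) : 0 ≤ G.cutGain γ S (C \ S) := by
  have hnode : ∀ v, gain G γ P {v} (π.best G P v) ≤ 0 := by
    intro v
    by_contra! hv
    obtain ⟨Q, hQ, hQpart, hlt⟩ := hP.exists_leidenStep_quality_lt π θ G hv
    exact absurd (hstab.quality_le hQ hQpart) (not_le.2 hlt)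
  have hmove : MoveNodesFast π G P P :=
    ⟨_, Finset.nodup_toList Finset.univ, by simp, moveLoop_self π G hnode _⟩
  -- Strong induction makes a violating `T` minimal: all its proper subsets satisfy the inequality.
  induction S using Finset.strongInductionOn with
  | _ T ih =>
    by_contra! hneg
    have hT : T.Nonempty := by
      rw [Finset.nonempty_iff_ne_empty]
      rintro rfl
      simp [cutGain_empty_left] at hneg
    have hCT : (C \ T).Nonempty := by
      rw [Finset.nonempty_iff_ne_empty]
      intro h
      rw [h, cutGain_comm, cutGain_empty_left] at hneg
      exact lt_irrefl _ hneg
    have hwell : ∀ A ⊂ T, A.Nonempty → WellConnected G γ C A := fun A hA _ =>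
      (wellConnected_iff G γ (hA.subset.trans hS)).2 (ih A hA (hA.subset.trans hS))
    have hgrow : ∀ A ⊂ T, A.Nonempty → ∃ v ∈ T \ A, 0 ≤ G.cutGain γ {v} A := by
      intro A hA hne
      by_contra! hlt
      have hB : T \ A ⊂ T := Finset.sdiff_ssubset hA.subset hne
      have hinner : G.cutGain γ (T \ A) A ≤ 0 := by
        rw [cutGain_eq_sum _ _ Finset.sdiff_disjoint]
        exact Finset.sum_nonpos fun v hv => (hlt v hv).le
      have h1 := ih A hA (hA.subset.trans hS)
      have h2 := ih _ hB (hB.subset.trans hS)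
      have e1 : C \ A = (T \ A) ∪ (C \ T) := by
        ext v
        have : v ∈ A → v ∈ T := fun h => hA.subset h
        have := @hS v
        simp only [Finset.mem_sdiff, Finset.mem_union]
        tauto
      have e2 : C \ (T \ A) = A ∪ (C \ T) := by
        ext v
        have : v ∈ A → v ∈ T := fun h => hA.subset h
        have := @hS v
        simp only [Finset.mem_sdiff, Finset.mem_union]
        tauto
      have hd : Disjoint (C \ T) T := Finset.sdiff_disjoint
      have hdA : Disjoint (C \ T) A := hd.mono_right hA.subset
      have hdB : Disjoint (C \ T) (T \ A) := hd.mono_right hB.subset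
      -- With B = T \ A, adding `h1` and `h2` gives 0 ≤ 2g(B, A) + g(T, C \ T), against `hinner` and
      -- `hneg`.
      rw [e1, cutGain_union_right _ _ Finset.disjoint_sdiff hdB.symm, cutGain_comm] at h1
      rw [e2, cutGain_union_right _ _ Finset.sdiff_disjoint hdA.symm] at h2
      have h3 := G.cutGain_union_left γ (Finset.sdiff_disjoint (s := A) (t := T)) hdB.symm
      rw [Finset.sdiff_union_of_subset hA.subset] at h3
      linarith
    have hR := isNodePartition_mergedPartition hT
    have hRP := exists_superset_of_mem_mergedPartition hP hC hS
    -- `C` contains nodes inside and outside `T`, so the iteration does not stop before refinement.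
    have hcard : P.card ≠ Fintype.card W := by
      refine (hP.card_lt hC ?_).ne
      have := Finset.card_sdiff_add_card_eq_card hS
      have := hT.card_pos
      have := hCT.card_pos
      omega
    let A : mergedPartition T := ⟨T, mem_mergedPartition.2 (Or.inl rfl)⟩
    -- The best move of the aggregate node `A` gains at least as much as splitting it off, that is
    -- -g(T, C \ T) > 0.
    have hbest := π.gain_le_best (aggregateGraph G (mergedPartition T))
      (aggregatePartition (mergedPartition T) P) A ∅ (Finset.mem_insert_self _ _)
    rw [hR.gain_aggregate_split hP hRP G γ hC hS] at hbest
    obtain ⟨Q, hQ, hQpart, hlt⟩ := (hR.aggregatePartition hP hRP).exists_leidenStep_quality_lt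
      π θ (aggregateGraph G (mergedPartition T)) ((neg_pos.2 hneg).trans_le hbest)
    rw [hR.quality_aggregatePartition hP hRP, ← hR.quality_flattenPartition hQpart] at hlt
    exact absurd (hstab.quality_le (.level hmove hcard
      (refinePartition_mergedPartition hC hS hT hwell hgrow) hQ) (hR.flattenPartition hQpart))
      (not_le.2 hlt)

end Leiden

theorem mainTheorem6 {V : Type u} [Fintype V] [DecidableEq V] (G : Network V)
    (γ θ : ℝ) (hγ : 0 < γ) (hθ : 0 < θ) (π : Leiden.Policy.{u} γ)
    (P : Finpartition (Finset.univ : Finset V))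
    (hP : Leiden.AsymptoticallyStable π θ G P.parts) :
    Leiden.UniformlyDense G γ P.parts ∧
      ∀ C ∈ P.parts, ∀ S ⊆ C,
        γ * (G.norm S : ℝ) * (G.norm (C \ S) : ℝ) ≤ (G.E S (C \ S) : ℝ) := by
  have hpart := Leiden.isNodePartition_parts P
  refine ⟨fun C hC S hS => ?_, fun C hC S hS => sub_nonneg.1 (hP.cutGain_nonneg hpart hC hS)⟩
  rw [hpart.gain_split_eq_neg_cutGain G γ hC hS]
  exact neg_nonpos.2 (hP.cutGain_nonneg hpart hC hS)
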